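/- Call a sequence $\langle f_n\rangle$ of polynomials weakly convergent to a formal power series $f=\sum_{k\ge 0} c_k z^k\in\mathbb C[[z]]$ if $\lim_{n\to\infty} f_n^{(k)}(0)/k! = c_k$ for every integer $k\ge 0$. For a polynomial $h$ with $h(0)\neq 0$ and zeros $a_1,\dots,a_d$, listed according to multiplicity, put $\tilde s_p(h)=\sum_{j=1}^{d}|a_j|^{-p}$. An entire function $g\not\equiv 0$ with nonzero zeros $a_1,a_2,\dots$ (finitely or infinitely many, listed according to multiplicity) has genus $q$ if there is a least integer $h\ge 0$ with $\sum_j |a_j|^{-(h+1)}<\infty$, and $$g(z)=z^m e^{Q(z)}\prod_j\Bigl(1-\frac{z}{a_j}\Bigr)\exp\Bigl(\sum_{k=1}^{h}\frac1k\Bigl(\frac{z}{a_j}\Bigr)^k\Bigr)\qquad(z\in\mathbb C)$$ for this $h$, where $m\ge 0$ is the order of vanishing of $g$ at $0$ and $Q$ is a polynomial, and $q=\max(\deg Q,h)$ (with $\deg Q=0$ for constant $Q$). **Theorem 2.3.** Let $p$ be a positive integer, let $M>0$, and let $\langle f_n\rangle$ be a sequence of polynomials with complex coefficients such that $f_n(0)\ne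 0$ for all $n$, $\lim_{n\to\infty}f_n(0)$ exists and is not $0$, $f_n\to f$ weakly for a formal power series $f$, and $\tilde s_p(f_n)\le M$ for all $n$. Then $f$ has infinite radius of convergence, so that it represents an entire function (again denoted by $f$), $f_n\to f$ uniformly on every compact subset of $\mathbb C$, and there are a constant $\alpha\in\mathbb C$ and an entire function $g$ of genus at most $p-1$ such that $$f(z)=e^{\alpha z^p}g(z)\qquad(z\in\mathbb C).$$ -/

import Mathlib

open Filter Topology

/-- A sequence `F` of functions analytic at `0` converges weakly to the formal power series `f`:
for every `k` the sequence `F n ^ (k) (0) / k!` converges to the `k`-th coefficient of `f`. -/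
def ConvergesWeakly (F : ℕ → ℂ → ℂ) (f : PowerSeries ℂ) : Prop :=
  ∀ k : ℕ, Tendsto (fun n => (1 / (Nat.factorial k : ℂ)) * iteratedDeriv k (F n) 0) atTop
    (𝓝 (PowerSeries.coeff k f))

/-- Strong convergence: uniform convergence on every compact set of the complex plane. -/
def ConvergesStrongly (F : ℕ → ℂ → ℂ) (G : ℂ → ℂ) : Prop :=
  ∀ K : Set ℂ, IsCompact K → TendstoUniformlyOn F G atTop K

/-- The formal power series `f` represents the entire function `F`. -/
def RepresentsEntire (f : PowerSeries ℂ) (F : ℂ → ℂ) : Prop :=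
  Differentiable ℂ F ∧ ∀ z : ℂ, HasSum (fun k : ℕ => PowerSeries.coeff k f * z ^ k) (F z)

/-- For a polynomial `P` with `P(0) ≠ 0`: the sum of `|a|⁻ᵏ` over the zeros `a` of `P`, counted
with multiplicity. -/
noncomputable def absZeroPowerSum (k : ℕ) (P : Polynomial ℂ) : ℝ :=
  (P.roots.map fun a => (‖a‖ ^ k)⁻¹).sum

/-- The Weierstrass elementary factor
`E_h(z) = (1 - z) exp (z + z ^ 2 / 2 + ⋯ + z ^ h / h)`. -/
noncomputable def elementaryFactor (h : ℕ) (z : ℂ) : ℂ :=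
  (1 - z) * Complex.exp (∑ j ∈ Finset.Icc 1 h, z ^ j / (j : ℂ))

/-- The set of nonzero zeros of `f`. -/
def nonzeroZeros (f : ℂ → ℂ) : Set ℂ := {a | f a = 0 ∧ a ≠ 0}

/-- The sum of `|a|⁻ᵏ` over the nonzero zeros `a` of `f`, each repeated according to its
multiplicity (the order of vanishing of `f` at `a`), is finite. -/
def ZeroPowersSummable (f : ℂ → ℂ) (k : ℕ) : Prop :=
  Summable fun a : nonzeroZeros f => (analyticOrderNatAt f (a : ℂ) : ℝ) * (‖(a : ℂ)‖ ^ k)⁻¹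

/-- The entire function `f` (not identically zero) has genus `q`: if `h` is the least natural
number for which the sum of `|a|^{-(h+1)}` over the nonzero zeros `a` of `f` (with multiplicity)
is finite, then `f(z) = z^m e^{Q(z)} ∏ E_h(z / a)`, where `m` is the order of vanishing of `f` at
`0`, `Q` is a polynomial, and `a` runs through the nonzero zeros with multiplicity; and
`q = max (deg Q) h`. The zero function has no genus, since the right side of the factorization
does not vanish identically. -/
def HasGenus (f : ℂ → ℂ) (q : ℕ) : Prop :=
  Differentiable ℂ f ∧
  ∃ (h : ℕ) (Q : Polynomial ℂ) (Pi : ℂ → ℂ),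
    IsLeast {l : ℕ | ZeroPowersSummable f (l + 1)} h ∧
    (∀ z : ℂ, HasProd
      (fun a : nonzeroZeros f =>
        elementaryFactor h (z / (a : ℂ)) ^ analyticOrderNatAt f (a : ℂ)) (Pi z)) ∧
    (∀ z : ℂ, f z = z ^ analyticOrderNatAt f 0 * Complex.exp (Q.eval z) * Pi z) ∧
    q = max Q.natDegree h

/-!
The power sums `s_k` of the inverse zeros of `f_n` are, up to sign, the Taylor coefficients of
the logarithmic derivative of `f_n`, so they converge for every `k ≥ 1`. Regrouping the linear
factors into elementary factors gives `f_n(z) = f_n(0) exp (-∑_{k ≤ p} s_k z^k / k) ∏ E_p(b_j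
z)`, where the inverse zeros `b_j`, sorted by decreasing modulus and continued by zeros, satisfy
`|b_j| ≤ (M / (j + 1))^(1/p)`. This majorant does not depend on `n` and is summable in the power
`p + 1`, so the product depends continuously on the parameters `(s, b, z)`. These parameters
stay in a compact set as long as `z` does: the `f_n` are locally bounded, hence converge locally
uniformly, and along a subsequence the `b_j` converge to some `β_j`. As `∑ |b_j|^p ≤ M`, also `∑
|β_j|^p ≤ M`, so the canonical product over the `β_j` has genus at most `p - 1`, and the term of
degree `p` of the exponent is what remains besides it.
-/

section ElementaryFactor

lemma elementaryFactor_eq_range (h : ℕ) (w : ℂ) :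
    elementaryFactor h w =
      (1 - w) * Complex.exp (∑ k ∈ Finset.range h, w ^ (k + 1) / ((k : ℂ) + 1)) := by
  rw [elementaryFactor, ← Finset.Ico_add_one_right_eq_Icc, Finset.sum_Ico_eq_sum_range]
  simp only [add_tsub_cancel_right, add_comm 1, Nat.cast_add, Nat.cast_one]

@[simp]
lemma elementaryFactor_zero (h : ℕ) : elementaryFactor h 0 = 1 := by
  simp [elementaryFactor_eq_range]

@[simp]
lemma elementaryFactor_eq_zero_iff {h : ℕ} {w : ℂ} : elementaryFactor h w = 0 ↔ w = 1 := by
  rw [elementaryFactor, mul_eq_zero, or_iff_left (Complex.exp_ne_zero _), sub_eq_zero, eq_comm]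

lemma elementaryFactor_eq_mul_exp {h H : ℕ} (hH : h ≤ H) (w : ℂ) :
    elementaryFactor H w =
      elementaryFactor h w *
        Complex.exp (∑ k ∈ Finset.Ico h H, w ^ (k + 1) / ((k : ℂ) + 1)) := by
  rw [elementaryFactor_eq_range, elementaryFactor_eq_range, mul_assoc, ← Complex.exp_add,
    Finset.sum_range_add_sum_Ico _ hH]

lemma hasDerivAt_elementaryFactor (h : ℕ) (w : ℂ) :
    HasDerivAt (elementaryFactor h)
      (-(w ^ h * Complex.exp (∑ k ∈ Finset.range h, w ^ (k + 1) / ((k : ℂ) + 1)))) w := by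
  have hexponent : HasDerivAt (fun w : ℂ => ∑ k ∈ Finset.range h, w ^ (k + 1) / ((k : ℂ) + 1))
      (∑ k ∈ Finset.range h, w ^ k) w := by
    refine HasDerivAt.fun_sum fun k _ => ?_
    refine ((hasDerivAt_pow (k + 1) w).div_const _).congr_deriv ?_
    rw [Nat.cast_add_one, add_tsub_cancel_right, mul_div_cancel_left₀ _ k.cast_add_one_ne_zero]
  rw [funext (elementaryFactor_eq_range h)]
  have hlinear : HasDerivAt (fun w : ℂ => 1 - w) (-1) w := (hasDerivAt_id' w).const_sub 1
  refine (hlinear.mul hexponent.cexp).congr_deriv ?_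
  -- The geometric sum telescopes against `1 - w`.
  linear_combination
    Complex.exp (∑ k ∈ Finset.range h, w ^ (k + 1) / ((k : ℂ) + 1)) * mul_neg_geom_sum w h

lemma differentiable_elementaryFactor (h : ℕ) : Differentiable ℂ (elementaryFactor h) :=
  fun w => (hasDerivAt_elementaryFactor h w).differentiableAt

lemma exists_norm_elementaryFactor_sub_one_le (h : ℕ) (R : ℝ) :
    ∃ C, ∀ w : ℂ, ‖w‖ ≤ R → ‖elementaryFactor h w - 1‖ ≤ C * ‖w‖ ^ (h + 1) := by
  have hcont : Continuous fun w : ℂ =>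
      Complex.exp (∑ k ∈ Finset.range h, w ^ (k + 1) / ((k : ℂ) + 1)) := by
    fun_prop
  obtain ⟨C, hC⟩ :=
    (isCompact_closedBall (0 : ℂ) R).exists_bound_of_continuousOn hcont.continuousOn
  refine ⟨C, fun w hw => ?_⟩
  have hderiv : ∀ x ∈ Metric.closedBall (0 : ℂ) ‖w‖,
      ‖-(x ^ h * Complex.exp (∑ k ∈ Finset.range h, x ^ (k + 1) / ((k : ℂ) + 1)))‖
        ≤ C * ‖w‖ ^ h := fun x hx => by
    rw [mem_closedBall_zero_iff] at hx
    rw [norm_neg, norm_mul, norm_pow, mul_comm]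
    have hCx := hC x (mem_closedBall_zero_iff.mpr (hx.trans hw))
    exact mul_le_mul hCx (by gcongr) (by positivity) ((norm_nonneg _).trans hCx)
  have hmean := (convex_closedBall (0 : ℂ) ‖w‖).norm_image_sub_le_of_norm_hasDerivWithin_le
    (fun x _ => (hasDerivAt_elementaryFactor h x).hasDerivWithinAt) hderiv
    (x := 0) (y := w) (by simp) (by simp)
  rwa [elementaryFactor_zero, sub_zero, mul_assoc, ← pow_succ] at hmean

lemma analyticOrderAt_elementaryFactor_inv_mul (h : ℕ) {a : ℂ} (ha : a ≠ 0) :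
    analyticOrderAt (fun z => elementaryFactor h (a⁻¹ * z)) a = 1 := by
  have hderiv : HasDerivAt (fun z => elementaryFactor h (a⁻¹ * z)) _ a :=
    (hasDerivAt_elementaryFactor h (a⁻¹ * a)).comp a ((hasDerivAt_id a).const_mul a⁻¹)
  refine AnalyticAt.analyticOrderAt_eq_one_of_zero_deriv_ne_zero ?_ ?_ ?_
  · exact ((differentiable_elementaryFactor h).comp (differentiable_id.const_mul a⁻¹)).analyticAt a
  · rw [inv_mul_cancel₀ ha, elementaryFactor_eq_zero_iff]
  · rw [hderiv.deriv, inv_mul_cancel₀ ha]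
    simp [ha, Complex.exp_ne_zero]

end ElementaryFactor

section SummablePowers

variable {ι : Type*} {v : ι → ℝ} {m : ℕ}

lemma exists_forall_le_of_summable_pow (hv : Summable fun i => v i ^ m) (hv0 : ∀ i, 0 ≤ v i)
    (hm : m ≠ 0) : ∃ B, ∀ i, v i ≤ B := by
  refine ⟨max 1 (∑' i, v i ^ m), fun i => ?_⟩
  rcases le_total (v i) 1 with hi | hi
  · exact hi.trans (le_max_left _ _)
  · calc v i ≤ v i ^ m := le_self_pow₀ hi hm
      _ ≤ ∑' i, v i ^ m := hv.le_tsum i fun j _ => pow_nonneg (hv0 j) m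
      _ ≤ _ := le_max_right _ _

lemma summable_pow_of_le (hv : Summable fun i => v i ^ m) (hv0 : ∀ i, 0 ≤ v i) (hm : m ≠ 0)
    {n : ℕ} (hmn : m ≤ n) : Summable fun i => v i ^ n := by
  refine hv.of_norm_bounded_eventually ?_
  filter_upwards [hv.tendsto_cofinite_zero.eventually_le_const one_pos] with i hi
  rw [Real.norm_of_nonneg (pow_nonneg (hv0 i) n)]
  exact pow_le_pow_of_le_one (hv0 i) ((pow_le_one_iff_of_nonneg (hv0 i) hm).mp hi) hmn

lemma finite_setOf_eq_of_summable_pow {E : Type*} [NormedAddCommGroup E] {b : ι → E}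
    (hb : Summable fun i => ‖b i‖ ^ m) {w : E} (hw : w ≠ 0) : {i | b i = w}.Finite := by
  have hlt := hb.tendsto_cofinite_zero.eventually_lt_const (pow_pos (norm_pos_iff.mpr hw) m)
  refine (Filter.eventually_cofinite.mp hlt).subset fun i (hi : b i = w) => ?_
  simp [hi]

end SummablePowers

/-- The canonical product `∏ E_h(b_i z)` of genus `h`. It is parametrized by the inverses `b_i` of
its zeros, so that an index with `b_i = 0` contributes the factor `1`. -/
noncomputable def canonicalProduct {ι : Type*} (h : ℕ) (b : ι → ℂ) (z : ℂ) : ℂ :=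
  ∏' i, elementaryFactor h (b i * z)

section CanonicalProduct

variable {ι : Type*} {b : ι → ℂ} {h : ℕ}

lemma exists_summable_bound_elementaryFactor {v : ι → ℝ} (hv : Summable fun i => v i ^ (h + 1))
    (hv0 : ∀ i, 0 ≤ v i) (R : ℝ) :
    ∃ u : ι → ℝ, Summable u ∧ ∀ i (b z : ℂ), ‖b‖ ≤ v i → ‖z‖ ≤ R →
      ‖elementaryFactor h (b * z) - 1‖ ≤ u i := by
  obtain ⟨B, hB⟩ := exists_forall_le_of_summable_pow hv hv0 h.succ_ne_zero
  obtain ⟨C, hC⟩ := exists_norm_elementaryFactor_sub_one_le h (B * R)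
  refine ⟨fun i => |C| * R ^ (h + 1) * v i ^ (h + 1), hv.mul_left _, fun i b z hb hz => ?_⟩
  have hbz : ‖b * z‖ ≤ v i * R := by
    rw [norm_mul]
    exact mul_le_mul hb hz (norm_nonneg _) (hv0 i)
  have hR : 0 ≤ R := (norm_nonneg z).trans hz
  calc ‖elementaryFactor h (b * z) - 1‖ ≤ C * ‖b * z‖ ^ (h + 1) :=
        hC _ (hbz.trans (by gcongr; exact hB i))
    _ ≤ |C| * (v i * R) ^ (h + 1) := by
        gcongr
        exact le_abs_self C
    _ = |C| * R ^ (h + 1) * v i ^ (h + 1) := by ring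

lemma hasProd_canonicalProduct (hb : Summable fun i => ‖b i‖ ^ (h + 1)) (z : ℂ) :
    HasProd (fun i => elementaryFactor h (b i * z)) (canonicalProduct h b z) := by
  obtain ⟨u, hu, hub⟩ := exists_summable_bound_elementaryFactor hb (fun _ => norm_nonneg _) ‖z‖
  have hmult := multipliable_one_add_of_summable
    (hu.of_nonneg_of_le (fun _ => norm_nonneg _) fun i => hub i (b i) z le_rfl le_rfl)
  simp only [add_sub_cancel] at hmult
  exact hmult.hasProd

lemma differentiable_canonicalProduct (hb : Summable fun i => ‖b i‖ ^ (h + 1)) :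
    Differentiable ℂ (canonicalProduct h b) := by
  intro z
  obtain ⟨u, hu, hub⟩ :=
    exists_summable_bound_elementaryFactor hb (fun _ => norm_nonneg _) (‖z‖ + 1)
  have hfactor : ∀ i, Differentiable ℂ fun z => elementaryFactor h (b i * z) := fun i =>
    (differentiable_elementaryFactor h).comp (differentiable_id.const_mul (b i))
  have hball : IsOpen (Metric.ball (0 : ℂ) (‖z‖ + 1)) := Metric.isOpen_ball
  have hprod := Summable.hasProdLocallyUniformlyOn_one_add
    (f := fun i z => elementaryFactor h (b i * z) - 1) hball hu
    (Eventually.of_forall fun i x hx => hub i (b i) x le_rfl (mem_ball_zero_iff.mp hx).le)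
    fun i => ((hfactor i).continuous.sub continuous_const).continuousOn
  simp only [add_sub_cancel] at hprod
  rw [hasProdLocallyUniformlyOn_iff_tendstoLocallyUniformlyOn] at hprod
  have hdiff : DifferentiableOn ℂ (canonicalProduct h b) (Metric.ball 0 (‖z‖ + 1)) :=
    hprod.differentiableOn (Eventually.of_forall fun s =>
      DifferentiableOn.fun_finsetProd fun i _ => (hfactor i).differentiableOn) hball
  exact hdiff.differentiableAt (hball.mem_nhds (by simp))

lemma continuousOn_canonicalProduct {v : ι → ℝ} (hv : Summable fun i => v i ^ (h + 1))
    (hv0 : ∀ i, 0 ≤ v i) :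
    ContinuousOn (fun x : (ι → ℂ) × ℂ => canonicalProduct h x.1 x.2)
      {x | ∀ i, ‖x.1 i‖ ≤ v i} := by
  rintro ⟨b, z⟩ -
  obtain ⟨u, hu, hub⟩ := exists_summable_bound_elementaryFactor hv hv0 (‖z‖ + 1)
  have hfactor : ∀ i, Continuous fun x : (ι → ℂ) × ℂ => elementaryFactor h (x.1 i * x.2) - 1 :=
    fun i => ((differentiable_elementaryFactor h).continuous.comp (by fun_prop)).sub
      continuous_const
  have hnear : ∀ᶠ x : (ι → ℂ) × ℂ in 𝓝 (b, z), ‖x.2‖ ≤ ‖z‖ + 1 :=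
    continuous_snd.norm.continuousAt.eventually_le_const (lt_add_one ‖z‖)
  have htendsto := tendsto_tprod_one_add_of_dominated_convergence
    (𝓕 := 𝓝[{x : (ι → ℂ) × ℂ | ∀ i, ‖x.1 i‖ ≤ v i}] (b, z))
    (f := fun x i => elementaryFactor h (x.1 i * x.2) - 1)
    (g := fun i => elementaryFactor h (b i * z) - 1) hu
    (fun i => ((hfactor i).tendsto (b, z)).mono_left nhdsWithin_le_nhds)
    (by filter_upwards [self_mem_nhdsWithin, nhdsWithin_le_nhds hnear] with x hx hz i
        exact hub i _ _ (hx i) hz)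
  simpa only [ContinuousWithinAt, canonicalProduct, add_sub_cancel] using htendsto

@[simp]
lemma canonicalProduct_eq_zero_iff (hb : Summable fun i => ‖b i‖ ^ (h + 1)) {z : ℂ} :
    canonicalProduct h b z = 0 ↔ ∃ i, b i * z = 1 := by
  refine ⟨fun hz => ?_, fun ⟨i, hi⟩ => tprod_of_exists_eq_zero ⟨i, by simp [hi]⟩⟩
  contrapose! hz
  obtain ⟨u, hu, hub⟩ := exists_summable_bound_elementaryFactor hb (fun _ => norm_nonneg _) ‖z‖
  have hne := tprod_one_add_ne_zero_of_summable (f := fun i => elementaryFactor h (b i * z) - 1)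
    (fun i => by simpa using hz i)
    (hu.of_nonneg_of_le (fun _ => norm_nonneg _) fun i => hub i (b i) z le_rfl le_rfl)
  simpa only [canonicalProduct, add_sub_cancel] using hne

lemma canonicalProduct_eq_pow_mul (hb : Summable fun i => ‖b i‖ ^ (h + 1)) {w : ℂ} (hw : w ≠ 0)
    (z : ℂ) :
    canonicalProduct h b z = elementaryFactor h (w * z) ^ {i | b i = w}.ncard *
      canonicalProduct h (fun i : ↥{i | b i = w}ᶜ => b i) z := by
  have : Fintype ↥{i | b i = w} := (finite_setOf_eq_of_summable_pow hb hw).fintype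
  have hcoincident : HasProd (fun i : ↥{i | b i = w} => elementaryFactor h (b i * z))
      (elementaryFactor h (w * z) ^ {i | b i = w}.ncard) := by
    convert hasProd_fintype (fun i : ↥{i | b i = w} => elementaryFactor h (b i * z)) using 1
    rw [Finset.prod_congr rfl fun i _ => by rw [i.2], Finset.prod_const, Finset.card_univ,
      ← Nat.card_eq_fintype_card, Nat.card_coe_set_eq]
  have hrest := hasProd_canonicalProduct (b := fun i : ↥{i | b i = w}ᶜ => b i) (hb.subtype _) z
  exact (HasProd.mul_compl (f := fun i => elementaryFactor h (b i * z)) hcoincident hrest).tprod_eq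

lemma analyticOrderAt_canonicalProduct (hb : Summable fun i => ‖b i‖ ^ (h + 1)) {a : ℂ}
    (ha : a ≠ 0) : analyticOrderAt (canonicalProduct h b) a = {i | b i = a⁻¹}.ncard := by
  have hrest : Summable fun i : ↥{i | b i = a⁻¹}ᶜ => ‖b i‖ ^ (h + 1) := hb.subtype _
  have hfactor : AnalyticAt ℂ (fun z => elementaryFactor h (a⁻¹ * z)) a :=
    ((differentiable_elementaryFactor h).comp (differentiable_id.const_mul a⁻¹)).analyticAt a
  have hrestAnalytic := (differentiable_canonicalProduct hrest).analyticAt a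
  have hrest_ne : canonicalProduct h (fun i : ↥{i | b i = a⁻¹}ᶜ => b i) a ≠ 0 := by
    rw [Ne, canonicalProduct_eq_zero_iff hrest]
    rintro ⟨i, hi⟩
    exact i.2 (eq_inv_of_mul_eq_one_left hi)
  have hsplit : canonicalProduct h b = (fun z => elementaryFactor h (a⁻¹ * z)) ^
      {i | b i = a⁻¹}.ncard * canonicalProduct h fun i : ↥{i | b i = a⁻¹}ᶜ => b i :=
    funext (canonicalProduct_eq_pow_mul hb (inv_ne_zero ha))
  rw [hsplit, analyticOrderAt_mul (hfactor.pow _) hrestAnalytic, analyticOrderAt_pow hfactor,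
    analyticOrderAt_elementaryFactor_inv_mul h ha,
    hrestAnalytic.analyticOrderAt_eq_zero.mpr hrest_ne]
  simp

end CanonicalProduct

section PowerSumPolynomial

open Polynomial

/-- The polynomial `∑_{k ∈ K} s_k z^(k+1) / (k+1)` which the exponents `k + 1`, `k ∈ K`, of the
elementary factors contribute to a product of such factors; `s_k` is the sum of the
`(k+1)`-st powers of the inverses of the zeros. -/
noncomputable def powerSumPolynomial (K : Finset ℕ) (s : ℕ → ℂ) : ℂ[X] :=
  ∑ k ∈ K, monomial (k + 1) (s k / (k + 1))

lemma eval_powerSumPolynomial (K : Finset ℕ) (s : ℕ → ℂ) (z : ℂ) :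
    (powerSumPolynomial K s).eval z = ∑ k ∈ K, s k * (z ^ (k + 1) / (k + 1)) := by
  simp only [powerSumPolynomial, eval_finsetSum, eval_monomial, div_mul_eq_mul_div, mul_div_assoc]

lemma natDegree_powerSumPolynomial_le {K : Finset ℕ} {H : ℕ} (hK : ∀ k ∈ K, k < H) (s : ℕ → ℂ) :
    (powerSumPolynomial K s).natDegree ≤ H :=
  natDegree_sum_le_of_forall_le _ _ fun k hk => (natDegree_monomial_le _).trans (hK k hk)

lemma natDegree_C_add_neg_powerSumPolynomial_le (a : ℂ) {K : Finset ℕ} {H : ℕ}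
    (hK : ∀ k ∈ K, k < H) (s : ℕ → ℂ) : (C a + -powerSumPolynomial K s).natDegree ≤ H := by
  rw [natDegree_C_add, natDegree_neg]
  exact natDegree_powerSumPolynomial_le hK s

lemma canonicalProduct_eq_exp_mul {ι : Type*} {b : ι → ℂ} {h H : ℕ}
    (hb : Summable fun i => ‖b i‖ ^ (h + 1)) (hH : h ≤ H) (z : ℂ) :
    canonicalProduct H b z =
      Complex.exp ((powerSumPolynomial (Finset.Ico h H) fun k => ∑' i, b i ^ (k + 1)).eval z) *
        canonicalProduct h b z := by
  have hpow : ∀ k ∈ Finset.Ico h H, Summable fun i => b i ^ (k + 1) := fun k hk => by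
    have hle : h + 1 ≤ k + 1 := Nat.succ_le_succ (Finset.mem_Ico.mp hk).1
    refine Summable.of_norm ?_
    simpa only [norm_pow] using summable_pow_of_le hb (fun _ => norm_nonneg _) h.succ_ne_zero hle
  have hexponent : HasSum (fun i => ∑ k ∈ Finset.Ico h H, (b i * z) ^ (k + 1) / ((k : ℂ) + 1))
      ((powerSumPolynomial (Finset.Ico h H) fun k => ∑' i, b i ^ (k + 1)).eval z) := by
    rw [eval_powerSumPolynomial]
    refine hasSum_sum fun k hk => ?_
    simpa only [mul_pow, mul_div_assoc] using
      (hpow k hk).hasSum.mul_right (z ^ (k + 1) / ((k : ℂ) + 1))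
  rw [← (hexponent.cexp.mul (hasProd_canonicalProduct hb z)).tprod_eq, canonicalProduct]
  refine tprod_congr fun i => ?_
  rw [elementaryFactor_eq_mul_exp hH, mul_comm, Function.comp_apply]

end PowerSumPolynomial

/-- The right side `e^{Q(z)} ∏ E_h(b_i z)` of a Hadamard factorization without a zero at the
origin, parametrized, like `canonicalProduct`, by the inverses `b_i` of the zeros. -/
noncomputable def hadamardProduct {ι : Type*} (Q : Polynomial ℂ) (h : ℕ) (b : ι → ℂ) (z : ℂ) : ℂ :=
  Complex.exp (Q.eval z) * canonicalProduct h b z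

section HadamardProduct

open Polynomial

variable {ι : Type*} {b : ι → ℂ} {h : ℕ} {Q : ℂ[X]}

lemma differentiable_hadamardProduct (hb : Summable fun i => ‖b i‖ ^ (h + 1)) :
    Differentiable ℂ (hadamardProduct Q h b) :=
  Q.differentiable.cexp.mul (differentiable_canonicalProduct hb)

lemma continuousOn_hadamardProduct {v : ι → ℝ} (hv : Summable fun i => v i ^ (h + 1))
    (hv0 : ∀ i, 0 ≤ v i) (K : Finset ℕ) :
    ContinuousOn (fun x : (ℕ → ℂ) × (ι → ℂ) × ℂ =>
      hadamardProduct (-powerSumPolynomial K x.1) h x.2.1 x.2.2) {x | ∀ i, ‖x.2.1 i‖ ≤ v i} := by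
  have hproduct : ContinuousOn (fun x : (ℕ → ℂ) × (ι → ℂ) × ℂ => canonicalProduct h x.2.1 x.2.2)
      {x | ∀ i, ‖x.2.1 i‖ ≤ v i} :=
    (continuousOn_canonicalProduct hv hv0).comp continuous_snd.continuousOn fun _ hx => hx
  simp only [hadamardProduct, eval_neg, eval_powerSumPolynomial]
  exact Continuous.continuousOn (by fun_prop) |>.mul hproduct

lemma mul_hadamardProduct {c : ℂ} (hc : c ≠ 0) (Q : ℂ[X]) (h : ℕ) (b : ι → ℂ) (z : ℂ) :
    c * hadamardProduct Q h b z = hadamardProduct (C (Complex.log c) + Q) h b z := by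
  rw [hadamardProduct, hadamardProduct, eval_add, eval_C, Complex.exp_add, Complex.exp_log hc,
    mul_assoc]

lemma hadamardProduct_eq_hadamardProduct_add {H : ℕ} (hb : Summable fun i => ‖b i‖ ^ (h + 1))
    (hH : h ≤ H) (Q : ℂ[X]) (z : ℂ) :
    hadamardProduct Q H b z = hadamardProduct
      (Q + powerSumPolynomial (Finset.Ico h H) fun k => ∑' i, b i ^ (k + 1)) h b z := by
  rw [hadamardProduct, hadamardProduct, canonicalProduct_eq_exp_mul hb hH, eval_add,
    Complex.exp_add, mul_assoc]

lemma hadamardProduct_eq_exp_mul_erase (Q : ℂ[X]) (h k : ℕ) (b : ι → ℂ) (z : ℂ) :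
    hadamardProduct Q h b z =
      Complex.exp (Q.coeff k * z ^ k) * hadamardProduct (Q.erase k) h b z := by
  rw [hadamardProduct, hadamardProduct, ← mul_assoc, ← Complex.exp_add, ← eval_monomial, ← eval_add,
    monomial_add_erase]

@[simp]
lemma hadamardProduct_eq_zero_iff (hb : Summable fun i => ‖b i‖ ^ (h + 1)) {z : ℂ} :
    hadamardProduct Q h b z = 0 ↔ ∃ i, b i * z = 1 := by
  rw [hadamardProduct, mul_eq_zero, or_iff_right (Complex.exp_ne_zero _),
    canonicalProduct_eq_zero_iff hb]

lemma analyticOrderNatAt_hadamardProduct_zero (hb : Summable fun i => ‖b i‖ ^ (h + 1)) :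
    analyticOrderNatAt (hadamardProduct Q h b) 0 = 0 := by
  have hne : hadamardProduct Q h b 0 ≠ 0 := by
    simp [hadamardProduct_eq_zero_iff hb]
  rw [analyticOrderNatAt,
    ((differentiable_hadamardProduct hb).analyticAt 0).analyticOrderAt_eq_zero.mpr hne,
    ENat.toNat_zero]

lemma preimage_inv_singleton {α : Type*} [InvolutiveInv α] (b : ι → α) (a : α) :
    (fun i => (b i)⁻¹) ⁻¹' {a} = {i | b i = a⁻¹} :=
  Set.ext fun _ => inv_eq_iff_eq_inv

lemma analyticOrderNatAt_hadamardProduct (hb : Summable fun i => ‖b i‖ ^ (h + 1)) {a : ℂ}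
    (ha : a ≠ 0) :
    analyticOrderNatAt (hadamardProduct Q h b) a = ((fun i => (b i)⁻¹) ⁻¹' {a}).ncard := by
  have hexp : AnalyticAt ℂ (fun z => Complex.exp (Q.eval z)) a := Q.differentiable.cexp.analyticAt a
  have hproduct : hadamardProduct Q h b =
      (fun z => Complex.exp (Q.eval z)) * canonicalProduct h b := rfl
  rw [analyticOrderNatAt, hproduct,
    analyticOrderAt_mul hexp ((differentiable_canonicalProduct hb).analyticAt a),
    hexp.analyticOrderAt_eq_zero.mpr (Complex.exp_ne_zero _), zero_add,
    analyticOrderAt_canonicalProduct hb ha, ENat.toNat_natCast, preimage_inv_singleton]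

end HadamardProduct

section Fibers

variable {α β M : Type*} {m : α → β}

@[to_additive]
lemma hasProd_fiber [CommMonoid M] [TopologicalSpace M] {F : β → M} {c : β}
    (hfin : F c ≠ 1 → (m ⁻¹' {c}).Finite) :
    HasProd (fun x : {x // m x = c} => F (m x)) (F c ^ (m ⁻¹' {c}).ncard) := by
  have hconst : (fun x : {x // m x = c} => F (m x)) = fun _ => F c :=
    funext fun x => congrArg F x.2
  rw [hconst]
  by_cases hc : F c = 1
  · simpa only [hc, one_pow] using hasProd_one
  · have : Fintype {x // m x = c} := (hfin hc).fintype
    convert hasProd_fintype (fun _ : {x // m x = c} => F c) using 1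
    rw [Finset.prod_const, Finset.card_univ, ← Nat.card_eq_fintype_card, ← Nat.card_coe_set_eq]
    rfl

@[to_additive]
lemma hasProd_pow_ncard_fiber [CommMonoid M] [TopologicalSpace M] [ContinuousMul M]
    [RegularSpace M] {F : β → M} {P : M} (hfin : ∀ c, F c ≠ 1 → (m ⁻¹' {c}).Finite)
    (hF : HasProd (fun x => F (m x)) P) : HasProd (fun c => F c ^ (m ⁻¹' {c}).ncard) P :=
  ((Equiv.sigmaFiberEquiv m).hasProd_iff.mpr hF).sigma fun c => hasProd_fiber (hfin c)

lemma summable_ncard_fiber_mul_iff {F : β → ℝ} (hF : ∀ c, 0 ≤ F c)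
    (hfin : ∀ c, F c ≠ 0 → (m ⁻¹' {c}).Finite) :
    (Summable fun c => ((m ⁻¹' {c}).ncard : ℝ) * F c) ↔ Summable fun x => F (m x) := by
  have hfiber := fun c => hasSum_fiber (hfin c)
  rw [← (Equiv.sigmaFiberEquiv m).summable_iff,
    summable_sigma_of_nonneg (f := (fun x => F (m x)) ∘ Equiv.sigmaFiberEquiv m) fun _ => hF _,
    and_iff_right]
  · exact summable_congr fun c => ((hfiber c).tsum_eq.trans (nsmul_eq_mul _ _)).symm
  · exact fun c => (hfiber c).summable

end Fibers

section Genus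

open Polynomial

variable {ι : Type*} {b : ι → ℂ} {h : ℕ}

lemma mem_nonzeroZeros_hadamardProduct (hb : Summable fun i => ‖b i‖ ^ (h + 1)) (Q : ℂ[X]) {a : ℂ}
    (ha : a ≠ 0) (hcard : ((fun i => (b i)⁻¹) ⁻¹' {a}).ncard ≠ 0) :
    a ∈ nonzeroZeros (hadamardProduct Q h b) := by
  obtain ⟨i, rfl⟩ := Set.nonempty_of_ncard_ne_zero hcard
  exact ⟨(hadamardProduct_eq_zero_iff hb).mpr ⟨i, mul_inv_cancel₀ (by simpa using ha)⟩, ha⟩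

lemma finite_preimage_inv_singleton (hb : Summable fun i => ‖b i‖ ^ (h + 1)) {a : ℂ} (ha : a ≠ 0) :
    ((fun i => (b i)⁻¹) ⁻¹' {a}).Finite := by
  rw [preimage_inv_singleton]
  exact finite_setOf_eq_of_summable_pow hb (inv_ne_zero ha)

lemma hasProd_nonzeroZeros_hadamardProduct (hb : Summable fun i => ‖b i‖ ^ (h + 1)) (Q : ℂ[X])
    (z : ℂ) :
    HasProd (fun a : nonzeroZeros (hadamardProduct Q h b) =>
      elementaryFactor h (z / (a : ℂ)) ^ analyticOrderNatAt (hadamardProduct Q h b) (a : ℂ))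
      (canonicalProduct h b z) := by
  have hne : ∀ a : ℂ, elementaryFactor h (z / a) ≠ 1 → a ≠ 0 := by
    rintro _ ha rfl
    exact ha (by rw [div_zero, elementaryFactor_zero])
  have hproduct : HasProd (fun i => elementaryFactor h (z / (b i)⁻¹)) (canonicalProduct h b z) := by
    simpa only [div_inv_eq_mul, mul_comm z] using hasProd_canonicalProduct hb z
  have hgrouped := hasProd_pow_ncard_fiber (F := fun a => elementaryFactor h (z / a))
    (fun a ha => finite_preimage_inv_singleton hb (hne a ha)) hproduct
  refine ((hasProd_subtype_iff_of_mulSupport_subset fun a ha => ?_).mpr hgrouped).congr_fun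
    fun a => ?_
  · have hfactor : elementaryFactor h (z / a) ≠ 1 := fun h1 => ha (by simp only [h1, one_pow])
    exact mem_nonzeroZeros_hadamardProduct hb Q (hne a hfactor) fun h0 => ha (by
      simp only [h0, pow_zero])
  · rw [analyticOrderNatAt_hadamardProduct hb a.2.2, Function.comp_apply]

lemma zeroPowersSummable_hadamardProduct_iff (hb : Summable fun i => ‖b i‖ ^ (h + 1)) (Q : ℂ[X])
    {k : ℕ} (hk : k ≠ 0) :
    ZeroPowersSummable (hadamardProduct Q h b) k ↔ Summable fun i => ‖b i‖ ^ k := by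
  have hne : ∀ a : ℂ, (‖a‖ ^ k)⁻¹ ≠ 0 → a ≠ 0 := by
    rintro _ ha rfl
    exact ha (by rw [norm_zero, zero_pow hk, inv_zero])
  have hgrouped := summable_ncard_fiber_mul_iff (F := fun a : ℂ => (‖a‖ ^ k)⁻¹)
    (fun a => by positivity) fun a ha => finite_preimage_inv_singleton hb (hne a ha)
  simp only [norm_inv, inv_pow, inv_inv] at hgrouped
  have hsupport : Function.support
      (fun a : ℂ => (((fun i => (b i)⁻¹) ⁻¹' {a}).ncard : ℝ) * (‖a‖ ^ k)⁻¹) ⊆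
        nonzeroZeros (hadamardProduct Q h b) := fun a ha =>
    mem_nonzeroZeros_hadamardProduct hb Q (hne a (right_ne_zero_of_mul ha))
      (Nat.cast_ne_zero.mp (left_ne_zero_of_mul ha))
  rw [← hgrouped, ← Set.indicator_eq_self.mpr hsupport, ← summable_subtype_iff_indicator]
  refine summable_congr fun a => ?_
  rw [analyticOrderNatAt_hadamardProduct hb a.2.2, Function.comp_apply]

theorem hasGenus_hadamardProduct (hb : IsLeast {l | Summable fun i => ‖b i‖ ^ (l + 1)} h)
    (Q : ℂ[X]) : HasGenus (hadamardProduct Q h b) (max Q.natDegree h) := by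
  have hsum : Summable fun i => ‖b i‖ ^ (h + 1) := hb.1
  refine ⟨differentiable_hadamardProduct hsum, h, Q, canonicalProduct h b, ?_,
    hasProd_nonzeroZeros_hadamardProduct hsum Q, fun z => ?_, rfl⟩
  · simpa only [zeroPowersSummable_hadamardProduct_iff hsum Q (Nat.succ_ne_zero _)] using hb
  · rw [analyticOrderNatAt_hadamardProduct_zero hsum, pow_zero, one_mul, hadamardProduct]

lemma natDegree_erase_le_pred {R : Type*} [Semiring R] {Q : R[X]} {p : ℕ} (hQ : Q.natDegree ≤ p) :
    (Q.erase p).natDegree ≤ p - 1 := by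
  rw [natDegree_le_iff_coeff_eq_zero]
  intro k hk
  rw [coeff_erase]
  split_ifs with hkp
  · rfl
  · exact coeff_eq_zero_of_natDegree_lt (by omega)

theorem exists_hasGenus_of_summable_pow {p : ℕ} (hp : p ≠ 0) (hb : Summable fun i => ‖b i‖ ^ p)
    {Q : ℂ[X]} (hQ : Q.natDegree ≤ p) :
    ∃ (α : ℂ) (g : ℂ → ℂ),
      (∀ z, hadamardProduct Q p b z = Complex.exp (α * z ^ p) * g z) ∧
      ∃ q ≤ p - 1, HasGenus g q := by
  classical
  have hp_pred : Summable fun i => ‖b i‖ ^ (p - 1 + 1) := by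
    rwa [Nat.sub_one_add_one hp]
  have hex : ∃ l, Summable fun i => ‖b i‖ ^ (l + 1) := ⟨p - 1, hp_pred⟩
  have hleast : IsLeast {l | Summable fun i => ‖b i‖ ^ (l + 1)} (Nat.find hex) :=
    ⟨Nat.find_spec hex, fun l hl => Nat.find_min' hex hl⟩
  have hle : Nat.find hex ≤ p - 1 := Nat.find_min' hex hp_pred
  set R := Q + powerSumPolynomial (Finset.Ico (Nat.find hex) p) fun k => ∑' i, b i ^ (k + 1)
  have hR : R.natDegree ≤ p := natDegree_add_le_of_degree_le hQ
    (natDegree_powerSumPolynomial_le (fun k hk => (Finset.mem_Ico.mp hk).2) _)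
  refine ⟨R.coeff p, hadamardProduct (R.erase p) (Nat.find hex) b, fun z => ?_, _,
    max_le (natDegree_erase_le_pred hR) hle, hasGenus_hadamardProduct hleast (R.erase p)⟩
  rw [hadamardProduct_eq_hadamardProduct_add hleast.1 (hle.trans (Nat.sub_le p 1)),
    hadamardProduct_eq_exp_mul_erase _ _ p]

end Genus

section ZeroPowerSum

open Polynomial

variable {K : Type*} [Field K]

/-- The sum of `a⁻ᵏ` over the zeros `a` of a polynomial, counted with multiplicity: the signed
counterpart of `absZeroPowerSum`. -/
noncomputable def zeroPowerSum (k : ℕ) (P : K[X]) : K :=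
  (P.roots.map fun a => (a ^ k)⁻¹).sum

lemma X_sub_C_mul_mk_inv_pow {a : K} (ha : a ≠ 0) :
    ((X - C a : K[X]) : PowerSeries K) * PowerSeries.mk (fun k => (a ^ (k + 1))⁻¹) = -1 := by
  have hgeom := PowerSeries.invUnitsSub_mul_sub (Units.mk0 a ha)
  have hmk : PowerSeries.invUnitsSub (Units.mk0 a ha) =
      PowerSeries.mk fun k => (a ^ (k + 1))⁻¹ := by
    ext k
    simp
  rw [hmk, Units.val_mk0] at hgeom
  rw [coe_sub, coe_X, coe_C]
  linear_combination -hgeom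

lemma derivative_prod_X_sub_C {s : Multiset K} (hs : ∀ a ∈ s, a ≠ 0) :
    PowerSeries.derivative K ((s.map fun a => X - C a).prod : K[X]) =
      -((s.map fun a => X - C a).prod : K[X]) *
        PowerSeries.mk fun k => (s.map fun a => (a ^ (k + 1))⁻¹).sum := by
  induction s using Multiset.induction_on with
  | empty =>
    ext k
    simp
  | cons a s ih =>
    rw [Multiset.forall_mem_cons] at hs
    have hmk : (PowerSeries.mk fun k => ((a ::ₘ s).map fun a => (a ^ (k + 1))⁻¹).sum) =
        PowerSeries.mk (fun k => (a ^ (k + 1))⁻¹) +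
          PowerSeries.mk fun k => (s.map fun a => (a ^ (k + 1))⁻¹).sum := by
      ext k
      simp
    have hlinear : PowerSeries.derivative K ((X - C a : K[X]) : PowerSeries K) = 1 := by
      rw [PowerSeries.derivative_coe, derivative_X_sub_C, coe_one]
    rw [Multiset.map_cons, Multiset.prod_cons, hmk, coe_mul, Derivation.leibniz, ih hs.2, hlinear,
      smul_eq_mul, smul_eq_mul]
    linear_combination
      (((s.map fun a => X - C a).prod : K[X]) : PowerSeries K) * X_sub_C_mul_mk_inv_pow hs.1

lemma ne_zero_of_mem_roots {P : K[X]} (hP : P.eval 0 ≠ 0) {a : K} (ha : a ∈ P.roots) : a ≠ 0 := by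
  rintro rfl
  exact hP (isRoot_of_mem_roots ha)

lemma derivative_eq_neg_mul_mk_zeroPowerSum {P : K[X]} (hsplits : P.Splits) (hP : P.eval 0 ≠ 0) :
    PowerSeries.derivative K (P : PowerSeries K) =
      -(P : PowerSeries K) * PowerSeries.mk fun k => zeroPowerSum (k + 1) P := by
  have hfactor : (P : PowerSeries K) =
      PowerSeries.C P.leadingCoeff * ((P.roots.map fun a => X - C a).prod : K[X]) := by
    rw [← coe_C, ← coe_mul, ← hsplits.eq_prod_roots]
  have hconst : PowerSeries.derivative K (PowerSeries.C P.leadingCoeff) = 0 :=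
    PowerSeries.derivative_C
  conv_lhs => rw [hfactor]
  rw [Derivation.leibniz, hconst, derivative_prod_X_sub_C fun a => ne_zero_of_mem_roots hP, hfactor]
  simp only [zeroPowerSum, smul_eq_mul]
  ring

lemma zeroPowerSum_succ_eq_coeff {P : K[X]} (hsplits : P.Splits) (hP : P.eval 0 ≠ 0) (k : ℕ) :
    zeroPowerSum (k + 1) P = PowerSeries.coeff k
      (-PowerSeries.derivative K (P : PowerSeries K) * (P : PowerSeries K)⁻¹) := by
  have hinv : (P : PowerSeries K) * (P : PowerSeries K)⁻¹ = 1 :=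
    PowerSeries.mul_inv_cancel _ (by
      rwa [constantCoeff_coe, coeff_zero_eq_eval_zero])
  have hmk : -PowerSeries.derivative K (P : PowerSeries K) * (P : PowerSeries K)⁻¹ =
      PowerSeries.mk fun k => zeroPowerSum (k + 1) P := by
    rw [derivative_eq_neg_mul_mk_zeroPowerSum hsplits hP]
    linear_combination (PowerSeries.mk fun k => zeroPowerSum (k + 1) P) * hinv
  rw [hmk, PowerSeries.coeff_mk]

end ZeroPowerSum

section ZeroPowerSumLimit

open scoped PowerSeries.WithPiTopology

variable {K α : Type*} [Field K] [TopologicalSpace K] [IsTopologicalDivisionRing K]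
  {l : Filter α}

lemma tendsto_powerSeries_inv {F : α → PowerSeries K} {f : PowerSeries K}
    (hF : Tendsto F l (𝓝 f)) (hf : PowerSeries.constantCoeff f ≠ 0) :
    Tendsto (fun n => (F n)⁻¹) l (𝓝 f⁻¹) := by
  rw [PowerSeries.WithPiTopology.tendsto_iff_coeff_tendsto] at hF ⊢
  have hinv : Tendsto (fun n => (PowerSeries.constantCoeff (F n))⁻¹) l
      (𝓝 (PowerSeries.constantCoeff f)⁻¹) := by
    simp only [← PowerSeries.coeff_zero_eq_constantCoeff_apply] at hf ⊢
    exact (hF 0).inv₀ hf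
  intro k
  induction k using Nat.strong_induction_on with
  | _ k ih =>
    rw [PowerSeries.coeff_inv, funext fun n => PowerSeries.coeff_inv k (F n)]
    split_ifs
    · exact hinv
    · refine hinv.neg.mul (tendsto_finsetSum _ fun x _ => ?_)
      split_ifs with hx
      · exact (hF x.1).mul (ih x.2 hx)
      · exact tendsto_const_nhds

lemma tendsto_powerSeries_derivative {F : α → PowerSeries K} {f : PowerSeries K}
    (hF : Tendsto F l (𝓝 f)) :
    Tendsto (fun n => PowerSeries.derivative K (F n)) l (𝓝 (PowerSeries.derivative K f)) := by
  rw [PowerSeries.WithPiTopology.tendsto_iff_coeff_tendsto] at hF ⊢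
  intro k
  simp only [PowerSeries.coeff_derivative]
  exact (hF (k + 1)).mul_const _

lemma tendsto_zeroPowerSum_succ {P : α → Polynomial K} {f : PowerSeries K}
    (hsplits : ∀ n, (P n).Splits) (hP : ∀ n, (P n).eval 0 ≠ 0)
    (hf : PowerSeries.constantCoeff f ≠ 0)
    (hlim : ∀ k, Tendsto (fun n => (P n).coeff k) l (𝓝 (PowerSeries.coeff k f))) (k : ℕ) :
    Tendsto (fun n => zeroPowerSum (k + 1) (P n)) l
      (𝓝 (PowerSeries.coeff k (-PowerSeries.derivative K f * f⁻¹))) := by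
  have hseries : Tendsto (fun n => (P n : PowerSeries K)) l (𝓝 f) := by
    simpa only [PowerSeries.WithPiTopology.tendsto_iff_coeff_tendsto, Polynomial.coeff_coe]
      using hlim
  have hquotient := (tendsto_powerSeries_derivative hseries).neg.mul
    (tendsto_powerSeries_inv hseries hf)
  simp only [zeroPowerSum_succ_eq_coeff (hsplits _) (hP _)]
  exact (PowerSeries.WithPiTopology.tendsto_iff_coeff_tendsto K _ _ _).mp hquotient k

end ZeroPowerSumLimit

section ZeroFactorization

open Polynomial

lemma eval_eq_eval_zero_mul_prod {K : Type*} [Field K] {P : K[X]} (hsplits : P.Splits)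
    (hP : P.eval 0 ≠ 0) (z : K) :
    P.eval z = P.eval 0 * (P.roots.map fun a => 1 - a⁻¹ * z).prod := by
  rw [hsplits.eval_eq_prod_roots z, hsplits.eval_eq_prod_roots 0, mul_assoc,
    ← Multiset.prod_map_mul]
  congr 2
  refine Multiset.map_congr rfl fun a ha => ?_
  have ha0 := ne_zero_of_mem_roots hP ha
  field_simp
  ring

lemma eval_eq_exp_mul_prod_elementaryFactor {P : ℂ[X]} (hP : P.eval 0 ≠ 0) (h : ℕ) (z : ℂ) :
    P.eval z = P.eval 0 *
      (Complex.exp ((-powerSumPolynomial (Finset.range h) fun k => zeroPowerSum (k + 1) P).eval z) *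
        (P.roots.map fun a => elementaryFactor h (a⁻¹ * z)).prod) := by
  have hexponent : (powerSumPolynomial (Finset.range h) fun k => zeroPowerSum (k + 1) P).eval z =
      (P.roots.map fun a => ∑ k ∈ Finset.range h, (a⁻¹ * z) ^ (k + 1) / ((k : ℂ) + 1)).sum := by
    simp only [eval_powerSumPolynomial, zeroPowerSum, ← Multiset.sum_map_mul_right, mul_pow,
      inv_pow, mul_div_assoc, Finset.sum_eq_multiset_sum]
    exact Multiset.sum_map_sum_map _ _
  have hfactors : (P.roots.map fun a => elementaryFactor h (a⁻¹ * z)).prod = Complex.exp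
      ((powerSumPolynomial (Finset.range h) fun k => zeroPowerSum (k + 1) P).eval z) *
        (P.roots.map fun a => 1 - a⁻¹ * z).prod := by
    rw [hexponent, Complex.exp_multiset_sum, Multiset.map_map, ← Multiset.prod_map_mul]
    simp only [elementaryFactor_eq_range, Function.comp_apply, mul_comm]
  rw [hfactors, eval_neg, ← mul_assoc (Complex.exp _), ← Complex.exp_add, neg_add_cancel,
    Complex.exp_zero, one_mul, ← eval_eq_eval_zero_mul_prod (IsAlgClosed.splits P) hP z]

end ZeroFactorization

/-- The sequence `b` lists the multiset `s`, with multiplicity, and continues with zeros. -/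
def IsPaddedEnumeration {E : Type*} [Zero E] (s : Multiset E) (b : ℕ → E) : Prop :=
  (Multiset.range s.card).map b = s ∧ ∀ j, s.card ≤ j → b j = 0

section Enumeration

variable {E : Type*} {s : Multiset E} {b : ℕ → E}

lemma exists_isPaddedEnumeration_antitone_norm [SeminormedAddGroup E] (s : Multiset E) :
    ∃ b : ℕ → E, IsPaddedEnumeration s b ∧ Antitone fun j => ‖b j‖ := by
  classical
  let r : E → E → Prop := fun x y => ‖y‖ ≤ ‖x‖
  have : Std.Total r := ⟨fun x y => le_total _ _⟩
  have : IsTrans E r := ⟨fun x y z hxy hyz => le_trans hyz hxy⟩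
  obtain ⟨l, hls, hl⟩ : ∃ l : List E, (l : Multiset E) = s ∧ l.Pairwise r :=
    ⟨s.toList.insertionSort r,
      by rw [Multiset.coe_eq_coe.mpr (List.perm_insertionSort r _), Multiset.coe_toList],
      List.pairwise_insertionSort r _⟩
  have hcard : s.card = l.length := by rw [← hls, Multiset.coe_card]
  refine ⟨fun j => l.getD j 0, ⟨?_, fun j hj => List.getD_eq_default _ _ (hcard ▸ hj)⟩,
    antitone_nat_of_succ_le fun j => ?_⟩
  · rw [hcard, ← hls, Multiset.range, Multiset.map_coe]
    congr 1
    refine List.ext_getElem (by simp) fun i hi _ => ?_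
    simp_all
  · by_cases hj : j + 1 < l.length
    · simp only [List.getD_eq_getElem _ _ hj, List.getD_eq_getElem _ _ (Nat.lt_of_succ_lt hj)]
      exact List.pairwise_iff_getElem.mp hl j (j + 1) _ hj j.lt_succ_self
    · simp only [List.getD_eq_default l 0 (not_lt.mp hj), norm_zero, norm_nonneg]

@[to_additive]
lemma IsPaddedEnumeration.hasProd [Zero E] {M : Type*} [CommMonoid M] [TopologicalSpace M]
    (hb : IsPaddedEnumeration s b) {F : E → M} (hF : F 0 = 1) :
    HasProd (fun j => F (b j)) (s.map F).prod := by
  have hprod : (s.map F).prod = ∏ j ∈ Finset.range s.card, F (b j) := by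
    conv_lhs => rw [← hb.1, Multiset.map_map]
    rfl
  rw [hprod]
  exact hasProd_prod_of_ne_finset_one fun j hj => by
    rw [hb.2 j (by simpa using hj), hF]

lemma succ_mul_le_of_antitone {a : ℕ → ℝ} (ha : Antitone a) {M : ℝ}
    (hM : ∀ N, ∑ j ∈ Finset.range N, a j ≤ M) (j : ℕ) : (j + 1) * a j ≤ M := by
  have hcard := Finset.card_nsmul_le_sum (Finset.range (j + 1)) a (a j) fun i hi =>
    ha (Finset.mem_range_succ_iff.mp hi)
  rw [Finset.card_range, nsmul_eq_mul, Nat.cast_add_one] at hcard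
  exact hcard.trans (hM (j + 1))

end Enumeration

/-- The largest value which the `j`-th term of a decreasing nonnegative sequence can take if the
`p`-th powers of its terms sum to at most `M`. -/
noncomputable def decayMajorant (p : ℕ) (M : ℝ) (j : ℕ) : ℝ :=
  (M / (j + 1)) ^ (p : ℝ)⁻¹

section DecayMajorant

variable {p : ℕ} {M : ℝ}

lemma decayMajorant_nonneg (hM : 0 ≤ M) (j : ℕ) : 0 ≤ decayMajorant p M j := by
  rw [decayMajorant]
  positivity

lemma le_decayMajorant {x : ℝ} (hx : 0 ≤ x) (hp : p ≠ 0) {j : ℕ} (hxj : (j + 1) * x ^ p ≤ M) :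
    x ≤ decayMajorant p M j := by
  have hpow : x ^ p ≤ M / (j + 1) := by
    rwa [le_div_iff₀' (by positivity)]
  rw [decayMajorant, ← Real.pow_rpow_inv_natCast hx hp]
  gcongr

lemma summable_decayMajorant_pow (hp : p ≠ 0) (hM : 0 ≤ M) {q : ℕ} (hpq : p < q) :
    Summable fun j => decayMajorant p M j ^ q := by
  have hexponent : 1 < (q : ℝ) / p := by
    rw [one_lt_div (by positivity)]
    exact_mod_cast hpq
  have hshift := (summable_nat_add_iff 1).mpr (Real.summable_one_div_nat_rpow.mpr hexponent)
  refine (hshift.mul_left (M ^ ((q : ℝ) / p))).congr fun j => ?_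
  rw [decayMajorant, ← Real.rpow_mul_natCast (by positivity), inv_mul_eq_div,
    Real.div_rpow hM (by positivity), mul_one_div, Nat.cast_add_one]

lemma exists_eval_eq_hadamardProduct {P : Polynomial ℂ} (hP : P.eval 0 ≠ 0) (hp : p ≠ 0)
    (hM : absZeroPowerSum p P ≤ M) :
    ∃ b : ℕ → ℂ, (∀ j, ‖b j‖ ≤ decayMajorant p M j) ∧
      (∀ N, ∑ j ∈ Finset.range N, ‖b j‖ ^ p ≤ M) ∧
      ∀ z, P.eval z = P.eval 0 * hadamardProduct
        (-powerSumPolynomial (Finset.range p) fun k => zeroPowerSum (k + 1) P) p b z := by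
  obtain ⟨b, henum, hanti⟩ := exists_isPaddedEnumeration_antitone_norm (P.roots.map (·⁻¹))
  have hsum : HasSum (fun j => ‖b j‖ ^ p) (absZeroPowerSum p P) := by
    simpa only [absZeroPowerSum, Multiset.map_map, Function.comp_def, norm_inv, inv_pow] using
      henum.hasSum (F := fun w => ‖w‖ ^ p) (by simp [hp])
  have hpartial : ∀ N, ∑ j ∈ Finset.range N, ‖b j‖ ^ p ≤ M := fun N =>
    (sum_le_hasSum _ (fun _ _ => by positivity) hsum).trans hM
  have hanti_pow : Antitone fun j => ‖b j‖ ^ p := fun i j hij =>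
    pow_le_pow_left₀ (norm_nonneg _) (hanti hij) p
  refine ⟨b, fun j => le_decayMajorant (norm_nonneg _) hp
    (succ_mul_le_of_antitone hanti_pow hpartial j), hpartial, fun z => ?_⟩
  have hproduct : canonicalProduct p b z =
      (P.roots.map fun a => elementaryFactor p (a⁻¹ * z)).prod := by
    simpa only [canonicalProduct, Multiset.map_map, Function.comp_def] using
      (henum.hasProd (F := fun w => elementaryFactor p (w * z)) (by simp)).tprod_eq
  rw [hadamardProduct, hproduct, ← eval_eq_exp_mul_prod_elementaryFactor hP]

end DecayMajorant

/-- The `k`-th Taylor coefficient at `0`, in the form in which it occurs in `ConvergesWeakly`. -/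
noncomputable def taylorCoeff (F : ℂ → ℂ) (k : ℕ) : ℂ :=
  (1 / (k.factorial : ℂ)) * iteratedDeriv k F 0

section EntireLimit

variable {F : ℂ → ℂ} {B : ℝ}

lemma hasSum_taylorCoeff (hF : Differentiable ℂ F) (z : ℂ) :
    HasSum (fun k => taylorCoeff F k * z ^ k) (F z) := by
  refine (Complex.hasSum_taylorSeries_of_entire hF 0 z).congr_fun fun k => ?_
  simp only [taylorCoeff, sub_zero, smul_eq_mul, one_div]
  ring

lemma norm_taylorCoeff_le (hF : Differentiable ℂ F) {r : ℝ} (hr : 0 < r)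
    (hB : ∀ z, ‖z‖ ≤ r → ‖F z‖ ≤ B) (k : ℕ) : ‖taylorCoeff F k‖ ≤ B / r ^ k := by
  have hcauchy := Complex.norm_iteratedDeriv_le_of_forall_mem_sphere_norm_le (c := 0) k hr
    hF.diffContOnCl fun z hz => hB z (mem_sphere_zero_iff_norm.mp hz).le
  rw [taylorCoeff, norm_mul, norm_div, norm_one, Complex.norm_natCast, one_div_mul_eq_div,
    div_le_iff₀' (by positivity)]
  rwa [mul_div_assoc] at hcauchy

lemma norm_taylorCoeff_mul_pow_le (hF : Differentiable ℂ F) {r : ℝ} (hr : 0 < r)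
    (hB : ∀ z, ‖z‖ ≤ r → ‖F z‖ ≤ B) {z : ℂ} (hz : ‖z‖ ≤ r / 2) (k : ℕ) :
    ‖taylorCoeff F k * z ^ k‖ ≤ B * (1 / 2) ^ k := by
  have hB0 : 0 ≤ B := (norm_nonneg _).trans (hB 0 (by simpa using hr.le))
  rw [norm_mul, norm_pow]
  calc ‖taylorCoeff F k‖ * ‖z‖ ^ k ≤ B / r ^ k * (r / 2) ^ k := by
        gcongr
        exact norm_taylorCoeff_le hF hr hB k
    _ = B * (1 / 2) ^ k := by
        rw [div_mul_comm, ← div_pow, div_right_comm, div_self hr.ne', mul_comm]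

variable {G : ℕ → ℂ → ℂ} {f : PowerSeries ℂ}

lemma exists_summable_bound_of_convergesWeakly (hG : ∀ n, Differentiable ℂ (G n))
    (hweak : ConvergesWeakly G f) (hbd : ∀ R : ℝ, ∃ B, ∀ n z, ‖z‖ ≤ R → ‖G n z‖ ≤ B) (R : ℝ) :
    ∃ u : ℕ → ℝ, Summable u ∧ ∀ k z, ‖z‖ ≤ R →
      (∀ n, ‖taylorCoeff (G n) k * z ^ k‖ ≤ u k) ∧ ‖PowerSeries.coeff k f * z ^ k‖ ≤ u k := by
  obtain ⟨B, hB⟩ := hbd (2 * (|R| + 1))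
  refine ⟨fun k => B * (1 / 2) ^ k, summable_geometric_two.mul_left B, fun k z hz => ?_⟩
  have hzR : ‖z‖ ≤ 2 * (|R| + 1) / 2 := by linarith [le_abs_self R]
  have hbound : ∀ n, ‖taylorCoeff (G n) k * z ^ k‖ ≤ B * (1 / 2) ^ k := fun n =>
    norm_taylorCoeff_mul_pow_le (hG n) (by positivity) (hB n) hzR k
  exact ⟨hbound, le_of_tendsto' ((hweak k).mul_const _).norm hbound⟩

theorem exists_convergesStrongly_of_convergesWeakly (hG : ∀ n, Differentiable ℂ (G n))
    (hweak : ConvergesWeakly G f) (hbd : ∀ R : ℝ, ∃ B, ∀ n z, ‖z‖ ≤ R → ‖G n z‖ ≤ B) :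
    ∃ F, RepresentsEntire f F ∧ ConvergesStrongly G F := by
  have hnear (z : ℂ) : ∀ᶠ w in 𝓝 z, ‖w‖ ≤ ‖z‖ + 1 :=
    continuous_norm.continuousAt.eventually_le_const (lt_add_one ‖z‖)
  set F : ℂ → ℂ := fun z => ∑' k, PowerSeries.coeff k f * z ^ k
  have hcont (z : ℂ) : Tendsto F (𝓝 z) (𝓝 (F z)) := by
    obtain ⟨u, hu, hub⟩ := exists_summable_bound_of_convergesWeakly hG hweak hbd (‖z‖ + 1)
    refine tendsto_tsum_of_dominated_convergence hu
      (fun k => (continuous_const.mul (continuous_pow k)).tendsto z) ?_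
    filter_upwards [hnear z] with w hw k using (hub k w hw).2
  have hjoint (z : ℂ) : Tendsto (fun x : ℕ × ℂ => G x.1 x.2) (atTop ×ˢ 𝓝 z) (𝓝 (F z)) := by
    obtain ⟨u, hu, hub⟩ := exists_summable_bound_of_convergesWeakly hG hweak hbd (‖z‖ + 1)
    simp only [← (hasSum_taylorCoeff (hG _) _).tsum_eq]
    refine tendsto_tsum_of_dominated_convergence hu (fun k => ((hweak k).comp tendsto_fst).mul
      (((continuous_pow k).tendsto z).comp tendsto_snd)) ?_
    filter_upwards [tendsto_snd.eventually (hnear z)] with x hx k using (hub k x.2 hx).1 x.1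
  have hlocal : TendstoLocallyUniformly G F atTop :=
    tendstoLocallyUniformly_iff_filter.mpr fun z =>
      (((hcont z).comp tendsto_snd).prodMk_nhds (hjoint z)).mono_right (nhds_le_uniformity _)
  refine ⟨F, ⟨?_, fun z => ?_⟩, tendstoLocallyUniformly_iff_forall_isCompact.mp hlocal⟩
  · rw [← differentiableOn_univ]
    exact (tendstoLocallyUniformlyOn_univ.mpr hlocal).differentiableOn
      (Eventually.of_forall fun n => (hG n).differentiableOn) isOpen_univ
  · obtain ⟨u, hu, hub⟩ := exists_summable_bound_of_convergesWeakly hG hweak hbd ‖z‖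
    exact (Summable.of_norm_bounded hu fun k => (hub k z le_rfl).2).hasSum

lemma taylorCoeff_eval (P : Polynomial ℂ) (k : ℕ) :
    taylorCoeff (fun z => P.eval z) k = P.coeff k := by
  have hiterate : ∀ z, iteratedDeriv k (fun z => P.eval z) z =
      (Polynomial.derivative^[k] P).eval z := by
    induction k with
    | zero => simp
    | succ k ih =>
      intro z
      rw [iteratedDeriv_succ, funext ih, Polynomial.deriv, Function.iterate_succ_apply']
  rw [taylorCoeff, hiterate, ← Polynomial.coeff_zero_eq_eval_zero,
    Polynomial.coeff_iterate_derivative, zero_add, Nat.descFactorial_self, nsmul_eq_mul,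
    one_div, inv_mul_cancel_left₀ (Nat.cast_ne_zero.mpr k.factorial_ne_zero)]

lemma convergesWeakly_eval_iff {P : ℕ → Polynomial ℂ} :
    ConvergesWeakly (fun n z => (P n).eval z) f ↔
      ∀ k, Tendsto (fun n => (P n).coeff k) atTop (𝓝 (PowerSeries.coeff k f)) := by
  simp only [← taylorCoeff_eval]
  rfl

end EntireLimit

lemma tendsto_zeroPowerSum_of_convergesWeakly {P : ℕ → Polynomial ℂ} {f : PowerSeries ℂ} {c : ℂ}
    (hP : ∀ n, (P n).eval 0 ≠ 0) (hc : c ≠ 0)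
    (hlim : Tendsto (fun n => (P n).eval 0) atTop (𝓝 c))
    (hweak : ConvergesWeakly (fun n z => (P n).eval z) f) :
    Tendsto (fun n k => zeroPowerSum (k + 1) (P n)) atTop
      (𝓝 fun k => PowerSeries.coeff k (-PowerSeries.derivative ℂ f * f⁻¹)) := by
  have hcoeff := convergesWeakly_eval_iff.mp hweak
  have hconst : PowerSeries.constantCoeff f = c := by
    rw [← PowerSeries.coeff_zero_eq_constantCoeff_apply]
    refine tendsto_nhds_unique (hcoeff 0) ?_
    simpa only [Polynomial.coeff_zero_eq_eval_zero] using hlim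
  exact tendsto_pi_nhds.mpr (tendsto_zeroPowerSum_succ
    (fun n => IsAlgClosed.splits (P n)) hP (hconst ▸ hc) hcoeff)

section Compactness

variable {ι : Type*} {v : ι → ℝ}

lemma isCompact_setOf_forall_norm_le (v : ι → ℝ) : IsCompact {b : ι → ℂ | ∀ i, ‖b i‖ ≤ v i} := by
  convert isCompact_univ_pi fun i => isCompact_closedBall (0 : ℂ) (v i) using 1
  ext b
  simp

lemma exists_bound_hadamardProduct {h : ℕ} (hv : Summable fun i => v i ^ (h + 1))
    (hv0 : ∀ i, 0 ≤ v i) (K : Finset ℕ) {S : Set (ℕ → ℂ)} (hS : IsCompact S) (R : ℝ) :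
    ∃ B, ∀ s ∈ S, ∀ b : ι → ℂ, (∀ i, ‖b i‖ ≤ v i) → ∀ z, ‖z‖ ≤ R →
      ‖hadamardProduct (-powerSumPolynomial K s) h b z‖ ≤ B := by
  have hcompact := hS.prod ((isCompact_setOf_forall_norm_le v).prod
    (isCompact_closedBall (0 : ℂ) R))
  obtain ⟨B, hB⟩ := hcompact.exists_bound_of_continuousOn
    ((continuousOn_hadamardProduct hv hv0 K).mono fun x hx => hx.2.1)
  exact ⟨B, fun s hs b hb z hz => hB (s, b, z) ⟨hs, hb, mem_closedBall_zero_iff.mpr hz⟩⟩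

lemma exists_bound_mul_hadamardProduct {h : ℕ} (hv : Summable fun i => v i ^ (h + 1))
    (hv0 : ∀ i, 0 ≤ v i) (K : Finset ℕ) {c : ℕ → ℂ} {c₀ : ℂ} (hc : Tendsto c atTop (𝓝 c₀))
    {s : ℕ → ℕ → ℂ} {σ : ℕ → ℂ} (hs : Tendsto s atTop (𝓝 σ)) {b : ℕ → ι → ℂ}
    (hb : ∀ n i, ‖b n i‖ ≤ v i) (R : ℝ) :
    ∃ B, ∀ n z, ‖z‖ ≤ R → ‖c n * hadamardProduct (-powerSumPolynomial K (s n)) h (b n) z‖ ≤ B := by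
  obtain ⟨C, hC⟩ := (Metric.isBounded_range_of_tendsto c hc).exists_norm_le
  obtain ⟨B, hB⟩ := exists_bound_hadamardProduct hv hv0 K hs.isCompact_insert_range R
  refine ⟨C * B, fun n z hz => ?_⟩
  rw [norm_mul]
  exact mul_le_mul (hC _ (Set.mem_range_self n))
    (hB _ (Set.mem_insert_of_mem _ (Set.mem_range_self n)) _ (hb n) z hz) (norm_nonneg _)
    ((norm_nonneg _).trans (hC _ (Set.mem_range_self n)))

lemma exists_subseq_tendsto_hadamardProduct [Countable ι] {h : ℕ}
    (hv : Summable fun i => v i ^ (h + 1)) (hv0 : ∀ i, 0 ≤ v i) (K : Finset ℕ)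
    {s : ℕ → ℕ → ℂ} {σ : ℕ → ℂ} (hs : Tendsto s atTop (𝓝 σ)) {b : ℕ → ι → ℂ}
    (hb : ∀ n i, ‖b n i‖ ≤ v i) :
    ∃ (β : ι → ℂ) (φ : ℕ → ℕ), StrictMono φ ∧ Tendsto (b ∘ φ) atTop (𝓝 β) ∧
      ∀ z, Tendsto (fun n => hadamardProduct (-powerSumPolynomial K (s (φ n))) h (b (φ n)) z) atTop
        (𝓝 (hadamardProduct (-powerSumPolynomial K σ) h β z)) := by
  obtain ⟨β, hβ, φ, hφ, hbβ⟩ := (isCompact_setOf_forall_norm_le v).tendsto_subseq hb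
  refine ⟨β, φ, hφ, hbβ, fun z => ?_⟩
  have hparam : Tendsto (fun n => (s (φ n), b (φ n), z)) atTop (𝓝 (σ, β, z)) :=
    (hs.comp hφ.tendsto_atTop).prodMk_nhds (hbβ.prodMk_nhds tendsto_const_nhds)
  exact (continuousOn_hadamardProduct hv hv0 K (σ, β, z) hβ).tendsto.comp
    (tendsto_nhdsWithin_iff.mpr ⟨hparam, Eventually.of_forall fun n => hb (φ n)⟩)

lemma summable_norm_pow_of_tendsto {α E : Type*} [SeminormedAddGroup E] {l : Filter α} [l.NeBot]
    {b : α → ℕ → E} {β : ℕ → E} (hb : Tendsto b l (𝓝 β)) {p : ℕ} {M : ℝ}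
    (hM : ∀ n N, ∑ j ∈ Finset.range N, ‖b n j‖ ^ p ≤ M) : Summable fun j => ‖β j‖ ^ p := by
  have hpartial (N : ℕ) : Tendsto (fun n => ∑ j ∈ Finset.range N, ‖b n j‖ ^ p) l
      (𝓝 (∑ j ∈ Finset.range N, ‖β j‖ ^ p)) :=
    tendsto_finsetSum _ fun j _ => ((hb.apply_nhds j).norm.pow p)
  exact summable_of_sum_range_le (fun _ => by positivity) fun N =>
    le_of_tendsto' (hpartial N) fun n => hM n N

end Compactness

theorem theorem2p3 (p : ℕ) (hp : 0 < p) (M : ℝ) (hM : 0 < M)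
    (P : ℕ → Polynomial ℂ) (f : PowerSeries ℂ) (c : ℂ)
    (hP0 : ∀ n, (P n).eval 0 ≠ 0)
    (hc : c ≠ 0) (hlim : Tendsto (fun n => (P n).eval 0) atTop (𝓝 c))
    (hweak : ConvergesWeakly (fun n z => (P n).eval z) f)
    (hbound : ∀ n, absZeroPowerSum p (P n) ≤ M) :
    ∃ F : ℂ → ℂ,
      RepresentsEntire f F ∧
      ConvergesStrongly (fun n z => (P n).eval z) F ∧
      ∃ (α : ℂ) (g : ℂ → ℂ),
        (∀ z : ℂ, F z = Complex.exp (α * z ^ p) * g z) ∧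
        ∃ q : ℕ, q ≤ p - 1 ∧ HasGenus g q := by
  have hpowerSum := tendsto_zeroPowerSum_of_convergesWeakly hP0 hc hlim hweak
  choose b hb hbsum hfactor using fun n =>
    exists_eval_eq_hadamardProduct (hP0 n) hp.ne' (hbound n)
  have hv := summable_decayMajorant_pow hp.ne' hM.le p.lt_succ_self
  have hv0 := decayMajorant_nonneg (p := p) hM.le
  obtain ⟨F, hF, hPF⟩ := exists_convergesStrongly_of_convergesWeakly
    (fun n => (P n).differentiable) hweak fun R => by
      obtain ⟨B, hB⟩ := exists_bound_mul_hadamardProduct hv hv0 _ hlim hpowerSum hb R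
      exact ⟨B, fun n z hz => hfactor n z ▸ hB n z hz⟩
  obtain ⟨β, φ, hφ, hbβ, hlimit⟩ :=
    exists_subseq_tendsto_hadamardProduct hv hv0 (Finset.range p) hpowerSum hb
  have hFβ (z : ℂ) : F z = c * _ := tendsto_nhds_unique
    (((hPF {z} isCompact_singleton).tendsto_at rfl).comp hφ.tendsto_atTop)
    (((hlim.comp hφ.tendsto_atTop).mul (hlimit z)).congr fun n => (hfactor (φ n) z).symm)
  simp only [mul_hadamardProduct hc] at hFβ
  obtain ⟨α, g, hg, hgenus⟩ := exists_hasGenus_of_summable_pow hp.ne'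
    (summable_norm_pow_of_tendsto hbβ fun n => hbsum (φ n))
    (natDegree_C_add_neg_powerSumPolynomial_le _ (fun _ => Finset.mem_range.mp) _)
  exact ⟨F, hF, hPF, α, g, fun z => (hFβ z).trans (hg z), hgenus⟩
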